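/- For subsets $A,B$ of a finite abelian group $G$ write $A+B=\{a+b\colon a\in A,\ b\in B\}$, let $\langle A\rangle$ denote the affine span of $A$ (the smallest coset of a subgroup of $G$ that contains $A$), let $\nu_{A,B}(g)$ be the number of representations $g=a+b$ with $a\in A$, $b\in B$, and let $\mu_{A,B}=\min\{\nu_{A,B}(g)\colon g\in A+B\}$. Let $k\ge 4$ be an integer and let $G$ be an elementary abelian $2$-group, that is, a finite abelian group in which $2g=0$ for all $g$. (1) Let $A$ and $B$ be nonempty subsets of $G$ such that $\langle A\rangle=\langle B\rangle=G$. If $$|A+B|<\min\{|A|+|B|,\,|G|\}\qquad\text{and}\qquad |B|\ge\Big(1-\frac{k+1}{2^k}\Big)|G|,$$ then the complement of $A+B$ in $G$ is contained in a coset of a subgroup of $G$ of index $2^k$. Moreover, if $\mu_{A,B}=1$, then the containment is strict, for every coset of a subgroup of index $2^k$ that contains the complement. (2) The bound on the index is best possible: if $|G|\ge 2^k$, then there are subsets $A,B$ of $G$ satisfying all the assumptions of (1) for which the complement of $A+B$ is not contained in a coset of any subgroup of $G$ of index larger than $2^k$. -/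

import Mathlib

open scoped Pointwise Finset

/-- The affine span `⟨A⟩` of a subset of an abelian group: the smallest coset containing `A`.
The `ℤ`-affine subspaces of an abelian group are the empty set and the cosets of subgroups. -/
def cosetSpan {G : Type*} [AddCommGroup G] (A : Set G) : Set G :=
  (affineSpan ℤ A : Set G)

/-- The span of a nonempty set is the least among the cosets of subgroups that contain it. -/
theorem isLeast_cosetSpan {G : Type*} [AddCommGroup G] {A : Set G} (hA : A.Nonempty) :
    IsLeast {C : Set G | (∃ (H : AddSubgroup G) (g : G), C = g +ᵥ (H : Set G)) ∧ A ⊆ C}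
      (cosetSpan A) := by
  obtain ⟨a, ha⟩ := hA
  have haS : a ∈ affineSpan ℤ A := subset_affineSpan ℤ A ha
  refine ⟨⟨⟨(affineSpan ℤ A).direction.toAddSubgroup, a, ?_⟩, subset_affineSpan ℤ A⟩, ?_⟩
  · ext x
    rw [Set.mem_vadd_set_iff_neg_vadd_mem]
    have h' := AffineSubspace.vsub_right_mem_direction_iff_mem haS x
    simp only [cosetSpan, SetLike.mem_coe, Submodule.mem_toAddSubgroup, vadd_eq_add]
    rw [neg_add_eq_sub]
    exact h'.symm
  · rintro C ⟨⟨H, g, rfl⟩, hC⟩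
    have key : ∀ x : G, x ∈ AffineSubspace.mk' g (AddSubgroup.toIntSubmodule H) ↔
        x ∈ g +ᵥ (H : Set G) := by
      intro x
      rw [Set.mem_vadd_set_iff_neg_vadd_mem, vadd_eq_add, neg_add_eq_sub,
        AffineSubspace.mem_mk']
      exact Iff.rfl
    have h : affineSpan ℤ A ≤ AffineSubspace.mk' g (AddSubgroup.toIntSubmodule H) := by
      rw [affineSpan_le]
      exact fun x hx => (key x).2 (hC hx)
    exact fun x hx => (key x).1 (h hx)

/-- The span of the empty set is empty, so `cosetSpan A = Set.univ` forces `A` to be nonempty. -/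
theorem cosetSpan_empty {G : Type*} [AddCommGroup G] : cosetSpan (∅ : Set G) = ∅ := by
  simp [cosetSpan]

/-- `μ_{A,B}`: the minimum over `g ∈ A + B` of the number `ν_{A,B}(g)` of representations
`g = a + b` with `a ∈ A` and `b ∈ B` (meaningful when `A` and `B` are nonempty). -/
noncomputable def minRepCount {G : Type*} [AddCommGroup G] [DecidableEq G]
    (A B : Finset G) : ℕ :=
  sInf ((fun g : G => A.addConvolution B g) '' ((A + B : Finset G) : Set G))

/-! Pass to the complement `C` of `A + B`. In characteristic 2, `A + C` avoids `B`, so `|A + C| <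
|A| + |C|` and `|A + C| ≤ (k + 1) / 2 ^ k * |G| < 3/8 * |G|`.

The core is `exists_subgroup_of_card_add_lt`, proved by the isoperimetric method. The boundary `|X +
A| - |X|` is submodular. A smallest minimizer among separating sets is a coset of a subgroup,
because translation by `x + y` swaps `x` and `y`. Take `F` maximal among the subgroups with least
boundary; then `|A + F| < |A| + |F|`. If `C` met two cosets of `F`, maximality would make `C + F +
A` miss at most one coset of `F`, and counting would give `|A + C| ≥ 3/8 * |G|`. So `C` lies in one
coset of `F`.

Let `F` have index `2 ^ j`. As `A` spans, it meets at least `j + 1` cosets of `F`, so `|A + C| ≥ |A|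
> j * |F|`. Comparison with the upper bound forces `j ≥ k`, and `F` is enlarged to index exactly `2
^ k`.

If `C` is a full coset of `H`, of index `2 ^ k`, then `A` meets exactly `k + 1` cosets of `H`, the
fewest that can span. A unique representation would create an affine dependence among them. For
sharpness, take `k + 1` cosets in general position and their complement. -/

theorem self_add_add_self {G : Type*} [AddCommGroup G] (hG : ∀ g : G, g + g = 0) (x y : G) :
    x + (x + y) = y := by
  rw [← add_assoc, hG, zero_add]

theorem neg_eq_self_of_add_self {G : Type*} [AddCommGroup G] (hG : ∀ g : G, g + g = 0) (x : G) :
    -x = x :=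
  neg_eq_of_add_eq_zero_left (hG x)

/-! ### Subgroups, indices and spanning by cosets. -/

section
variable {G : Type*} [AddCommGroup G] [Fintype G]

open Classical in
/-- A subgroup of a finite group as a finset. -/
noncomputable def subgroupFinset (F : AddSubgroup G) : Finset G := Finset.univ.filter (· ∈ F)

@[simp]
theorem mem_subgroupFinset {F : AddSubgroup G} {x : G} : x ∈ subgroupFinset F ↔ x ∈ F := by
  simp [subgroupFinset]

theorem subgroupFinset_nonempty (F : AddSubgroup G) : (subgroupFinset F).Nonempty :=
  ⟨0, by simp [F.zero_mem]⟩

theorem card_subgroupFinset_pos (F : AddSubgroup G) : 0 < #(subgroupFinset F) :=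
  (subgroupFinset_nonempty F).card_pos

theorem subgroupFinset_bot : subgroupFinset (⊥ : AddSubgroup G) = 0 := by
  ext
  simp

theorem card_subgroupFinset_bot : #(subgroupFinset (⊥ : AddSubgroup G)) = 1 := by
  rw [subgroupFinset_bot, Finset.card_zero]

theorem index_mul_card_subgroupFinset (F : AddSubgroup G) :
    F.index * #(subgroupFinset F) = Fintype.card G := by
  classical
  have h := F.index_mul_card
  rw [Nat.card_eq_fintype_card, Nat.card_eq_fintype_card] at h
  rw [← h, subgroupFinset, Fintype.card_subtype]

/-- Adjoining an element outside of a subgroup halves the index. -/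
theorem exists_subgroup_adjoin (hG : ∀ g : G, g + g = 0) (F : AddSubgroup G) {t : G}
    (ht : t ∉ F) : ∃ K : AddSubgroup G, F ≤ K ∧ t ∈ K ∧ F.index = 2 * K.index ∧
      ∀ L : AddSubgroup G, F ≤ L → t ∈ L → K ≤ L := by
  classical
  -- This is `F ∪ (t + F)`, closed under addition because `t + t = 0`.
  let K : AddSubgroup G :=
    { carrier := {x | x ∈ F ∨ t + x ∈ F}
      zero_mem' := Or.inl F.zero_mem
      neg_mem' := by
        intro x hx
        simpa [neg_eq_self_of_add_self hG] using hx
      add_mem' := by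
        rintro x y (hx | hx) (hy | hy)
        · exact Or.inl (F.add_mem hx hy)
        · refine Or.inr ?_
          have := F.add_mem hx hy
          rwa [add_left_comm] at this
        · refine Or.inr ?_
          have := F.add_mem hx hy
          rwa [add_assoc] at this
        · refine Or.inl ?_
          have := F.add_mem hx hy
          rwa [add_add_add_comm, hG, zero_add] at this }
  have hK : ∀ x, x ∈ K ↔ x ∈ F ∨ t + x ∈ F := fun x => Iff.rfl
  have hcard : #(subgroupFinset K) = 2 * #(subgroupFinset F) := by
    have : subgroupFinset K = subgroupFinset F ∪ (t +ᵥ subgroupFinset F) := by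
      ext x
      rw [Finset.mem_union, ← Finset.neg_vadd_mem_iff, neg_eq_self_of_add_self hG]
      simp [hK]
    rw [this, Finset.card_union_of_disjoint, Finset.card_vadd_finset, two_mul]
    rw [Finset.disjoint_left]
    intro x hx hx'
    rw [← Finset.neg_vadd_mem_iff, neg_eq_self_of_add_self hG, vadd_eq_add] at hx'
    simp only [mem_subgroupFinset] at hx hx'
    exact ht ((F.add_mem_cancel_right hx).1 hx')
  refine ⟨K, fun x hx => Or.inl hx, Or.inr (by rw [hG]; exact F.zero_mem), ?_, ?_⟩
  · have h1 := index_mul_card_subgroupFinset F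
    have h2 := index_mul_card_subgroupFinset K
    rw [hcard, ← h1] at h2
    have := card_subgroupFinset_pos F
    apply Nat.eq_of_mul_eq_mul_right this
    rw [← h2]; ring
  · rintro L hFL htL x (hx | hx)
    · exact hFL hx
    · exact (L.add_mem_cancel_left htL).1 (hFL hx)

theorem exists_index_eq_two_pow (hG : ∀ g : G, g + g = 0) (F : AddSubgroup G) :
    ∃ j, F.index = 2 ^ j := by
  induction h : F.index using Nat.strong_induction_on generalizing F with
  | _ m ih =>
    by_cases hF : F = ⊤
    · exact ⟨0, by rw [← h, hF]; simp⟩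
    · obtain ⟨t, ht⟩ : ∃ t, t ∉ F := by
        by_contra! hcon
        exact hF (by ext; simp [hcon])
      obtain ⟨K, -, -, hK, -⟩ := exists_subgroup_adjoin hG F ht
      have hpos : K.index ≠ 0 := AddSubgroup.index_ne_zero_of_finite
      obtain ⟨j, hj⟩ := ih K.index (by omega) K rfl
      exact ⟨j + 1, by rw [← h, hK, hj]; ring⟩

theorem exists_le_index_eq_two_pow (hG : ∀ g : G, g + g = 0) (i k : ℕ) (F : AddSubgroup G)
    (hF : F.index = 2 ^ (k + i)) : ∃ K : AddSubgroup G, F ≤ K ∧ K.index = 2 ^ k := by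
  induction i generalizing F with
  | zero => exact ⟨F, le_rfl, hF⟩
  | succ i ih =>
    obtain ⟨t, ht⟩ : ∃ t, t ∉ F := by
      by_contra! hcon
      have : F = ⊤ := by ext; simp [hcon]
      rw [this, AddSubgroup.index_top] at hF
      have := Nat.one_lt_two_pow (n := k + (i + 1)) (by omega)
      omega
    obtain ⟨K, hFK, -, hK, -⟩ := exists_subgroup_adjoin hG F ht
    obtain ⟨L, hKL, hL⟩ := ih K (by rw [← add_assoc, pow_succ] at hF; omega)
    exact ⟨L, hFK.trans hKL, hL⟩

/-- A subgroup of index `2 ^ k` together with `k` suitable elements generates the group. -/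
theorem exists_finset_generating (hG : ∀ g : G, g + g = 0) (k : ℕ) (F : AddSubgroup G)
    (hF : F.index = 2 ^ k) : ∃ T : Finset G, #T ≤ k ∧
      ∀ L : AddSubgroup G, F ≤ L → (∀ t ∈ T, t ∈ L) → L = ⊤ := by
  classical
  induction k generalizing F with
  | zero =>
    refine ⟨∅, by simp, fun L hL _ => ?_⟩
    rw [pow_zero, AddSubgroup.index_eq_one] at hF
    exact top_le_iff.1 (hF ▸ hL)
  | succ k ih =>
    obtain ⟨t, ht⟩ : ∃ t, t ∉ F := by
      by_contra! hcon
      have : F = ⊤ := by ext; simp [hcon]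
      rw [this, AddSubgroup.index_top] at hF
      have := Nat.one_lt_two_pow (n := k + 1) (by omega)
      omega
    obtain ⟨K, hFK, -, hK, hmin⟩ := exists_subgroup_adjoin hG F ht
    obtain ⟨T, hT, hgen⟩ := ih K (by rw [pow_succ] at hF; omega)
    refine ⟨insert t T, (Finset.card_insert_le _ _).trans (by omega), fun L hL hTL => ?_⟩
    exact hgen L (hmin L hL (hTL t (by simp))) fun s hs => hTL s (by simp [hs])

/-- Each adjoined element at worst halves the index. -/
theorem exists_subgroup_index_le (hG : ∀ g : G, g + g = 0) (F : AddSubgroup G) (T : Finset G) :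
    ∃ K : AddSubgroup G, F ≤ K ∧ (∀ t ∈ T, t ∈ K) ∧ F.index ≤ 2 ^ #T * K.index := by
  classical
  induction T using Finset.induction_on with
  | empty => exact ⟨F, le_rfl, by simp, by simp⟩
  | insert t T ht ih =>
    obtain ⟨K, hFK, hTK, hK⟩ := ih
    rw [Finset.card_insert_of_notMem ht]
    by_cases htK : t ∈ K
    · refine ⟨K, hFK, by simpa [htK] using hTK, hK.trans ?_⟩
      gcongr <;> simp
    · obtain ⟨L, hKL, htL, hL, -⟩ := exists_subgroup_adjoin hG K htK
      refine ⟨L, hFK.trans hKL, ?_, ?_⟩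
      · simpa [htL] using fun s hs => hKL (hTK s hs)
      · rw [hL] at hK
        rw [pow_succ]
        linarith

open Classical in
theorem card_add_subgroupFinset [DecidableEq G] (A : Finset G) (F : AddSubgroup G) :
    #(A + subgroupFinset F) =
      #(A.image (QuotientAddGroup.mk : G → G ⧸ F)) * #(subgroupFinset F) := by
  have him : (A + subgroupFinset F).image (QuotientAddGroup.mk : G → G ⧸ F)
      = A.image (QuotientAddGroup.mk : G → G ⧸ F) := by
    ext q
    simp only [Finset.mem_image, Finset.mem_add, mem_subgroupFinset]
    constructor
    · rintro ⟨_, ⟨a, ha, f, hf, rfl⟩, rfl⟩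
      exact ⟨a, ha, by rw [QuotientAddGroup.eq]; simpa using hf⟩
    · rintro ⟨a, ha, rfl⟩
      exact ⟨a, ⟨a, ha, 0, F.zero_mem, add_zero a⟩, rfl⟩
  rw [← him, Finset.card_eq_sum_card_image (QuotientAddGroup.mk : G → G ⧸ F)]
  refine Finset.sum_const_nat fun q hq => ?_
  rw [him] at hq
  obtain ⟨a, ha, rfl⟩ := Finset.mem_image.1 hq
  rw [← Finset.card_vadd_finset a (subgroupFinset F)]
  congr 1
  ext x
  rw [← Finset.neg_vadd_mem_iff, vadd_eq_add]
  simp only [Finset.mem_filter, Finset.mem_add, mem_subgroupFinset]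
  constructor
  · rintro ⟨-, h⟩
    exact QuotientAddGroup.eq.1 h.symm
  · intro h
    exact ⟨⟨a, ha, _, h, by simp⟩, (QuotientAddGroup.eq.2 h).symm⟩

theorem card_subgroupFinset_dvd [DecidableEq G] {X : Finset G} {F : AddSubgroup G}
    (hX : X + subgroupFinset F = X) : #(subgroupFinset F) ∣ #X := by
  classical
  rw [← hX, card_add_subgroupFinset]
  exact dvd_mul_left _ _

/-- A set that, together with the subgroup `F`, affinely spans the group meets more than
`log₂` of the index of `F` cosets of `F`. -/
theorem exists_card_add_eq_of_span [DecidableEq G] (hG : ∀ g : G, g + g = 0) {A : Finset G}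
    {F : AddSubgroup G} {a₀ : G} (ha₀ : a₀ ∈ A)
    (hspan : ∀ K : AddSubgroup G, F ≤ K → (∀ a ∈ A, a + a₀ ∈ K) → K = ⊤) :
    ∃ n : ℕ, #(A + subgroupFinset F) = (n + 1) * #(subgroupFinset F) ∧ F.index ≤ 2 ^ n := by
  classical
  set S := A.image (QuotientAddGroup.mk : G → G ⧸ F)
  have hmem : (a₀ : G ⧸ F) ∈ S := Finset.mem_image_of_mem _ ha₀
  -- Adjoin to `F` one difference from `a₀` for every other coset that `A` meets; spanning makes the
  -- result the whole group.
  obtain ⟨K, hFK, hTK, hK⟩ := exists_subgroup_index_le hG F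
    ((S.erase (a₀ : G ⧸ F)).image fun q => q.out + a₀)
  refine ⟨#(S.erase (a₀ : G ⧸ F)), ?_, ?_⟩
  · rw [card_add_subgroupFinset, Finset.card_erase_add_one hmem]
  · have htop : K = ⊤ := by
      refine hspan K hFK fun a ha => ?_
      by_cases h : (a : G ⧸ F) = a₀
      · have := QuotientAddGroup.eq.1 h
        rw [neg_eq_self_of_add_self hG] at this
        exact hFK this
      · have h1 := hTK ((a : G ⧸ F).out + a₀) (Finset.mem_image.2 ⟨a, Finset.mem_erase.2
          ⟨h, Finset.mem_image_of_mem _ ha⟩, rfl⟩)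
        have h2 : a + (a : G ⧸ F).out ∈ F := by
          have := QuotientAddGroup.eq.1 (QuotientAddGroup.out_eq' (a : G ⧸ F)).symm
          rwa [neg_eq_self_of_add_self hG] at this
        have h3 := K.add_mem (hFK h2) h1
        rwa [add_assoc, self_add_add_self hG] at h3
    rw [htop, AddSubgroup.index_top, mul_one] at hK
    exact hK.trans (Nat.pow_le_pow_right (by norm_num) Finset.card_image_le)
end

/-! ### Boundary, submodularity and separating sets. -/

section
variable {G : Type*} [AddCommGroup G] [DecidableEq G]

/-- The boundary size `|X + A| - |X|`. -/
def boundarySize (A X : Finset G) : ℤ := (#(X + A) : ℤ) - #X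

theorem boundarySize_vadd (A X : Finset G) (g : G) :
    boundarySize A (g +ᵥ X) = boundarySize A X := by
  simp [boundarySize, vadd_add_assoc]

/-- Adding `A` commutes with unions, but for intersections only an inclusion survives; this is the
source of submodularity. -/
theorem card_inter_add_le (A X Y : Finset G) :
    #((X ∩ Y) + A) + #((X ∪ Y) + A) ≤ #(X + A) + #(Y + A) := by
  rw [← Finset.card_inter_add_card_union (X + A) (Y + A), Finset.union_add]
  gcongr
  exact Finset.inter_add_subset

theorem boundarySize_submodular (A X Y : Finset G) :
    boundarySize A (X ∩ Y) + boundarySize A (X ∪ Y) ≤ boundarySize A X + boundarySize A Y := by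
  have h1 := card_inter_add_le A X Y
  have h2 := Finset.card_inter_add_card_union X Y
  unfold boundarySize
  omega

variable [Fintype G]

/-- The nonempty unions of at least two cosets of `F` whose sum with `A` misses at least
`2 |F|` elements. -/
structure IsSeparating (A : Finset G) (F : AddSubgroup G) (X : Finset G) : Prop where
  periodic : X + subgroupFinset F = X
  two_mul_le : 2 * #(subgroupFinset F) ≤ #X
  card_add_le : #(X + A) + 2 * #(subgroupFinset F) ≤ Fintype.card G

theorem vadd_eq_self_of_periodic {X : Finset G} {F : AddSubgroup G}
    (hX : X + subgroupFinset F = X) {g : G} (hg : g ∈ F) : g +ᵥ X = X := by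
  apply Finset.eq_of_subset_of_card_le
  · intro x hx
    obtain ⟨y, hy, rfl⟩ := Finset.mem_vadd_finset.1 hx
    rw [← hX, vadd_eq_add, add_comm X]
    exact Finset.add_mem_add (by simpa using hg) hy
  · rw [Finset.card_vadd_finset]

theorem add_mem_of_periodic {X : Finset G} {F : AddSubgroup G}
    (hX : X + subgroupFinset F = X) {x g : G} (hx : x ∈ X) (hg : g ∈ F) : x + g ∈ X := by
  rw [← hX]
  exact Finset.add_mem_add hx (by simpa using hg)

theorem periodic_of_add_mem {X : Finset G} {F : AddSubgroup G}
    (h : ∀ x ∈ X, ∀ g ∈ F, x + g ∈ X) : X + subgroupFinset F = X := by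
  apply Finset.Subset.antisymm
  · intro y hy
    obtain ⟨x, hx, g, hg, rfl⟩ := Finset.mem_add.1 hy
    exact h x hx g (by simpa using hg)
  · intro x hx
    exact Finset.mem_add.2 ⟨x, hx, 0, by simp [F.zero_mem], add_zero x⟩

theorem subgroupFinset_add_self (F : AddSubgroup G) :
    subgroupFinset F + subgroupFinset F = subgroupFinset F :=
  periodic_of_add_mem (by simpa using fun x hx g hg => F.add_mem hx hg)

theorem periodic_add_right {X A : Finset G} {F : AddSubgroup G}
    (hX : X + subgroupFinset F = X) : (X + A) + subgroupFinset F = X + A := by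
  rw [add_right_comm, hX]

theorem periodic_compl {X : Finset G} {F : AddSubgroup G}
    (hX : X + subgroupFinset F = X) : Xᶜ + subgroupFinset F = Xᶜ := by
  refine periodic_of_add_mem fun x hx g hg => ?_
  rw [Finset.mem_compl] at hx ⊢
  intro h
  have := add_mem_of_periodic hX h (F.neg_mem hg)
  rw [add_neg_cancel_right] at this
  exact hx this

theorem periodic_inter {X Y : Finset G} {F : AddSubgroup G}
    (hX : X + subgroupFinset F = X) (hY : Y + subgroupFinset F = Y) :
    (X ∩ Y) + subgroupFinset F = X ∩ Y := by
  refine periodic_of_add_mem fun x hx g hg => ?_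
  rw [Finset.mem_inter] at hx ⊢
  exact ⟨add_mem_of_periodic hX hx.1 hg, add_mem_of_periodic hY hx.2 hg⟩

theorem periodic_vadd {X : Finset G} {F : AddSubgroup G}
    (hX : X + subgroupFinset F = X) (g : G) : (g +ᵥ X) + subgroupFinset F = g +ᵥ X := by
  rw [vadd_add_assoc, hX]

theorem periodic_union {X Y : Finset G} {F : AddSubgroup G}
    (hX : X + subgroupFinset F = X) (hY : Y + subgroupFinset F = Y) :
    (X ∪ Y) + subgroupFinset F = X ∪ Y := by
  rw [Finset.union_add, hX, hY]

theorem disjoint_cosets (hG : ∀ g : G, g + g = 0) {F : AddSubgroup G} {x y : G}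
    (hxy : x + y ∉ F) : Disjoint (x +ᵥ subgroupFinset F) (y +ᵥ subgroupFinset F) := by
  rw [Finset.disjoint_left]
  intro z hz hz'
  rw [← Finset.neg_vadd_mem_iff, neg_eq_self_of_add_self hG, mem_subgroupFinset,
    vadd_eq_add] at hz hz'
  have := F.add_mem hz hz'
  rw [add_add_add_comm, hG, add_zero] at this
  exact hxy this

theorem coset_subset_of_periodic {X : Finset G} {F : AddSubgroup G}
    (hX : X + subgroupFinset F = X) {x : G} (hx : x ∈ X) : x +ᵥ subgroupFinset F ⊆ X := by
  intro z hz
  obtain ⟨g, hg, rfl⟩ := Finset.mem_vadd_finset.1 hz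
  exact add_mem_of_periodic hX hx (by simpa using hg)

theorem two_mul_card_le_of_periodic (hG : ∀ g : G, g + g = 0) {X : Finset G} {F : AddSubgroup G}
    (hX : X + subgroupFinset F = X) {x y : G} (hx : x ∈ X) (hy : y ∈ X) (hxy : x + y ∉ F) :
    2 * #(subgroupFinset F) ≤ #X := by
  have h := Finset.card_le_card (Finset.union_subset (coset_subset_of_periodic hX hx)
    (coset_subset_of_periodic hX hy))
  rw [Finset.card_union_of_disjoint (disjoint_cosets hG hxy), Finset.card_vadd_finset,
    Finset.card_vadd_finset] at h
  omega

/-- Among the separating sets, the smallest boundary is attained at a subgroup. -/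
theorem exists_separating_subgroup (hG : ∀ g : G, g + g = 0) {A : Finset G}
    {F : AddSubgroup G} (hex : ∃ X, IsSeparating A F X) :
    ∃ K : AddSubgroup G, F ≤ K ∧ IsSeparating A F (subgroupFinset K) ∧
      ∀ X, IsSeparating A F X → boundarySize A (subgroupFinset K) ≤ boundarySize A X := by
  classical
  set P : Finset (Finset G) := Finset.univ.filter (IsSeparating A F) with hP
  have memP : ∀ X, X ∈ P ↔ IsSeparating A F X := by simp [hP]
  obtain ⟨X₀, hX₀P, hX₀⟩ := P.exists_min_image (boundarySize A) (by
    obtain ⟨X, hX⟩ := hex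
    exact ⟨X, (memP X).2 hX⟩)
  -- An atom: a set of least size among those of least boundary.
  obtain ⟨X, hXQ, hX⟩ := (P.filter fun X => boundarySize A X = boundarySize A X₀).exists_min_image
    Finset.card ⟨X₀, by simp [hX₀P]⟩
  rw [Finset.mem_filter, memP] at hXQ
  obtain ⟨hXs, hXb⟩ := hXQ
  have hbmin : ∀ Y, IsSeparating A F Y → boundarySize A X ≤ boundarySize A Y := fun Y hY => by
    rw [hXb]; exact hX₀ Y ((memP Y).2 hY)
  have hcmin : ∀ Y, IsSeparating A F Y → boundarySize A Y = boundarySize A X → #X ≤ #Y :=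
    fun Y hY h => hX Y (by rw [Finset.mem_filter, memP]; exact ⟨hY, h.trans hXb⟩)
  have hpos := card_subgroupFinset_pos F
  -- the complement of `X + A` is separating too, which bounds the size of `X`
  have hdualsub : (X + A)ᶜ + A ⊆ Xᶜ := by
    intro z hz
    obtain ⟨y, hy, a, ha, rfl⟩ := Finset.mem_add.1 hz
    rw [Finset.mem_compl] at hy ⊢
    intro h
    apply hy
    have := Finset.add_mem_add h ha
    rwa [add_assoc, hG, add_zero] at this
  have hdual := Finset.card_le_card hdualsub
  have hc1 := Finset.card_add_card_compl X
  have hc2 := Finset.card_add_card_compl (X + A)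
  have h2 := hXs.two_mul_le
  have h3 := hXs.card_add_le
  have hsize : #X + #(X + A) ≤ Fintype.card G := by
    have hs : IsSeparating A F (X + A)ᶜ :=
      ⟨periodic_compl (periodic_add_right hXs.periodic), by omega, by omega⟩
    have hb := hbmin _ hs
    have := hcmin _ hs (by unfold boundarySize at hb ⊢; omega)
    omega
  -- The translate by `x + y` again contains `x` and `y`, so its intersection with `X` is
  -- separating. Submodularity makes that intersection a minimizer, and minimality of `#X` makes it
  -- all of `X`.
  have key : ∀ x ∈ X, ∀ y ∈ X, (x + y) +ᵥ X = X := by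
    intro x hx y hy
    by_cases hxy : x + y ∈ F
    · exact vadd_eq_self_of_periodic hXs.periodic hxy
    set Y := (x + y) +ᵥ X with hY
    have hYb : boundarySize A Y = boundarySize A X := boundarySize_vadd A X _
    have hYcard : #Y = #X := Finset.card_vadd_finset _ _
    have hYp : Y + subgroupFinset F = Y := periodic_vadd hXs.periodic _
    have hxY : x ∈ Y := Finset.mem_vadd_finset.2 ⟨y, hy, by
      rw [vadd_eq_add, add_assoc, hG, add_zero]⟩
    have hyY : y ∈ Y := Finset.mem_vadd_finset.2 ⟨x, hx, by
      rw [vadd_eq_add, add_right_comm, hG, zero_add]⟩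
    have hIp := periodic_inter hXs.periodic hYp
    have hI2 := two_mul_card_le_of_periodic hG hIp (Finset.mem_inter.2 ⟨hx, hxY⟩)
      (Finset.mem_inter.2 ⟨hy, hyY⟩) hxy
    have hIle : #((X ∩ Y) + A) ≤ #(X + A) :=
      Finset.card_le_card (Finset.add_subset_add_right Finset.inter_subset_left)
    have hIs : IsSeparating A F (X ∩ Y) := ⟨hIp, hI2, by omega⟩
    have hIb := hbmin _ hIs
    have hsub := boundarySize_submodular A X Y
    have hcu := Finset.card_inter_add_card_union X Y
    -- Submodularity gives `|(X ∪ Y) + A| ≤ |X + A| + |X| - 2 |F|`, and `hsize` bounds this by `|G|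
    -- - 2 |F|`.
    have hUs : IsSeparating A F (X ∪ Y) := by
      refine ⟨periodic_union hXs.periodic hYp, ?_, ?_⟩
      · exact h2.trans (Finset.card_le_card Finset.subset_union_left)
      · unfold boundarySize at hsub hIb hYb
        omega
    have hUb := hbmin _ hUs
    have hle := hcmin _ hIs (by omega)
    have hIX : X ∩ Y = X := Finset.eq_of_subset_of_card_le Finset.inter_subset_left hle
    exact (Finset.eq_of_subset_of_card_le (Finset.inter_eq_left.1 hIX) hYcard.le).symm
  obtain ⟨x₀, hx₀⟩ : X.Nonempty := Finset.card_pos.1 (by omega)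
  set K : AddSubgroup G := AddAction.stabilizer G X with hKdef
  have hKX : x₀ +ᵥ subgroupFinset K = X := by
    ext z
    rw [← Finset.neg_vadd_mem_iff, neg_eq_self_of_add_self hG, mem_subgroupFinset, hKdef,
      AddAction.mem_stabilizer_iff, vadd_eq_add]
    constructor
    · intro h
      rw [← h]
      exact Finset.mem_vadd_finset.2 ⟨x₀, hx₀, by
        rw [vadd_eq_add, add_right_comm, hG, zero_add]⟩
    · exact fun h => key x₀ hx₀ z h
  have hFK : F ≤ K := fun g hg => vadd_eq_self_of_periodic hXs.periodic hg
  have hKb : boundarySize A (subgroupFinset K) = boundarySize A X := by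
    rw [← boundarySize_vadd A _ x₀, hKX]
  have hKc : #(subgroupFinset K) = #X := by rw [← Finset.card_vadd_finset x₀, hKX]
  refine ⟨K, hFK, ⟨?_, ?_, ?_⟩, ?_⟩
  · exact periodic_of_add_mem (by simpa using fun x hx g hg => K.add_mem hx (hFK hg))
  · omega
  · unfold boundarySize at hKb
    omega
  · intro Y hY
    rw [hKb]
    exact hbmin Y hY

/-! ### Completing cosets, and counting half-full cosets. -/

/-- Filling up the cosets of an extremal subgroup does not increase the boundary. -/
theorem boundarySize_add_subgroup_le {A : Finset G} {F : AddSubgroup G}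
    (hF : IsSeparating A ⊥ (subgroupFinset F))
    (hmin : ∀ X, IsSeparating A ⊥ X → boundarySize A (subgroupFinset F) ≤ boundarySize A X)
    (hFA : boundarySize A (subgroupFinset F) ≤ #A - 1) (C : Finset G) :
    boundarySize A (C + subgroupFinset F) ≤ boundarySize A C := by
  have main : ∀ D ⊆ C, boundarySize A (C ∪ (D + subgroupFinset F)) ≤ boundarySize A C := by
    intro D
    induction D using Finset.induction_on with
    | empty => simp
    | insert x D hx ih =>
      intro hD
      rw [Finset.insert_subset_iff] at hD
      have hu : C ∪ (insert x D + subgroupFinset F) =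
          (C ∪ (D + subgroupFinset F)) ∪ (x +ᵥ subgroupFinset F) := by
        rw [Finset.insert_eq, Finset.union_add, Finset.singleton_add, Finset.union_comm (x +ᵥ _),
          Finset.union_assoc]
      rw [hu]
      set X := C ∪ (D + subgroupFinset F)
      have hsub := boundarySize_submodular A X (x +ᵥ subgroupFinset F)
      rw [boundarySize_vadd] at hsub
      have hxI : x ∈ X ∩ (x +ᵥ subgroupFinset F) := by
        refine Finset.mem_inter.2 ⟨Finset.mem_union_left _ hD.1,
          Finset.mem_vadd_finset.2 ⟨0, by simp [F.zero_mem], by simp⟩⟩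
      -- A one-point intersection has boundary `#A - 1`; a larger one is separating, since it lies
      -- in a coset of `F`.
      have hI : boundarySize A (subgroupFinset F) ≤
          boundarySize A (X ∩ (x +ᵥ subgroupFinset F)) := by
        have h1 : 1 ≤ #(X ∩ (x +ᵥ subgroupFinset F)) := Finset.card_pos.2 ⟨x, hxI⟩
        rcases h1.eq_or_lt with h1 | h1
        · obtain ⟨y, hy⟩ := Finset.card_eq_one.1 h1.symm
          rw [hy]
          simpa [boundarySize] using hFA
        · refine hmin _ ⟨?_, ?_, ?_⟩
          · exact periodic_of_add_mem (by simp)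
          · rw [card_subgroupFinset_bot]; omega
          · refine le_trans ?_ hF.card_add_le
            gcongr 1
            rw [← Finset.card_vadd_finset x (subgroupFinset F + A), ← vadd_add_assoc]
            exact Finset.card_le_card (Finset.add_subset_add_right Finset.inter_subset_right)
      have := ih hD.2
      omega
  have hC : C ∪ (C + subgroupFinset F) = C + subgroupFinset F := by
    refine Finset.union_eq_right.2 fun x hx => ?_
    exact Finset.mem_add.2 ⟨x, hx, 0, by simp [F.zero_mem], add_zero x⟩
  have := main C subset_rfl
  rwa [hC] at this

/-- If every coset of `F` that meets `U` contains at least `|F| / 2` elements of `D`, then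
`|U| ≤ 2 |D|`. -/
theorem card_le_two_mul_card_of_half (hG : ∀ g : G, g + g = 0) {U D : Finset G}
    {F : AddSubgroup G}
    (h : ∀ y ∈ U, #(subgroupFinset F) ≤ 2 * #(D ∩ (y +ᵥ subgroupFinset F))) :
    #U ≤ 2 * #D := by
  have hmem : ∀ y d : G, d ∈ y +ᵥ subgroupFinset F ↔ d + y ∈ F := fun y d => by
    rw [← Finset.neg_vadd_mem_iff, neg_eq_self_of_add_self hG, mem_subgroupFinset, vadd_eq_add,
      add_comm]
  -- Double count the pairs in `U × D` lying in a common coset of `F`.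
  have hdc := Finset.sum_card_bipartiteAbove_eq_sum_card_bipartiteBelow (s := U) (t := D)
    (fun y d => d ∈ y +ᵥ subgroupFinset F)
  have h1 : #U * #(subgroupFinset F) ≤
      2 * ∑ y ∈ U, #(D.bipartiteAbove (fun y d => d ∈ y +ᵥ subgroupFinset F) y) := by
    rw [Finset.mul_sum, ← smul_eq_mul, ← Finset.sum_const]
    refine Finset.sum_le_sum fun y hy => (h y hy).trans_eq ?_
    rw [Finset.bipartiteAbove, Finset.filter_mem_eq_inter]
  have h2 : ∑ d ∈ D, #(U.bipartiteBelow (fun y d => d ∈ y +ᵥ subgroupFinset F) d) ≤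
      #D * #(subgroupFinset F) := by
    rw [← smul_eq_mul, ← Finset.sum_const]
    refine Finset.sum_le_sum fun d _ => ?_
    rw [← Finset.card_vadd_finset d (subgroupFinset F)]
    refine Finset.card_le_card fun y hy => ?_
    have : d ∈ y +ᵥ subgroupFinset F := (Finset.mem_filter.1 hy).2
    rwa [hmem, add_comm, ← hmem] at this
  rw [hdc] at h1
  refine Nat.le_of_mul_le_mul_right ?_ (card_subgroupFinset_pos F)
  calc _ ≤ _ := h1
    _ ≤ 2 * (#D * #(subgroupFinset F)) := by omega
    _ = _ := by ring
end

/-- Sizes of `F`-periodic sets are multiples of `|F|`, so strict inequalities between them gain a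
full `|F|`. -/
theorem add_le_of_dvd_of_lt {d m n : ℕ} (hm : d ∣ m) (hn : d ∣ n) (h : m < n) : m + d ≤ n := by
  have := Nat.le_of_dvd (by omega) (Nat.dvd_sub hn hm)
  omega

/-! ### Small sumsets `A + C` with `A` spanning. -/

section
variable {G : Type*} [AddCommGroup G] [Fintype G] [DecidableEq G]

theorem mem_vadd_subgroupFinset (hG : ∀ g : G, g + g = 0) {F : AddSubgroup G} {x y : G} :
    x ∈ y +ᵥ subgroupFinset F ↔ y + x ∈ F := by
  rw [← Finset.neg_vadd_mem_iff, neg_eq_self_of_add_self hG, mem_subgroupFinset, vadd_eq_add]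

theorem subset_add_subgroupFinset (A : Finset G) (F : AddSubgroup G) :
    A ⊆ A + subgroupFinset F := fun x hx =>
  Finset.mem_add.2 ⟨x, hx, 0, by simp [F.zero_mem], add_zero x⟩

theorem add_subgroupFinset_periodic (A : Finset G) (F : AddSubgroup G) :
    (A + subgroupFinset F) + subgroupFinset F = A + subgroupFinset F := by
  rw [add_assoc, subgroupFinset_add_self]

theorem coset_periodic (x : G) (F : AddSubgroup G) :
    (x +ᵥ subgroupFinset F) + subgroupFinset F = x +ᵥ subgroupFinset F := by
  rw [vadd_add_assoc, subgroupFinset_add_self]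

/-- If fewer than `|F|` elements are missing from the `F`-cosets that meet `A`, then all these
cosets but at most one are at least half full. -/
theorem exists_forall_half_le (hG : ∀ g : G, g + g = 0) {A : Finset G} (hA : A.Nonempty)
    {F : AddSubgroup G} (h : #(A + subgroupFinset F) < #A + #(subgroupFinset F)) :
    ∃ a₁ ∈ A, ∀ a ∈ A, a + a₁ ∉ F →
      #(subgroupFinset F) ≤ 2 * #(A ∩ (a +ᵥ subgroupFinset F)) := by
  -- Two cosets less than half full would together miss more than `|F|` elements.
  by_cases hl : ∃ a₁ ∈ A, 2 * #(A ∩ (a₁ +ᵥ subgroupFinset F)) < #(subgroupFinset F)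
  · obtain ⟨a₁, ha₁, hlight⟩ := hl
    refine ⟨a₁, ha₁, fun a ha haF => ?_⟩
    have hholes : ∀ x : G, #((x +ᵥ subgroupFinset F) \ A) + #(A ∩ (x +ᵥ subgroupFinset F)) =
        #(subgroupFinset F) := fun x => by
      rw [Finset.inter_comm, Finset.card_sdiff_add_card_inter, Finset.card_vadd_finset]
    have h1 := hholes a
    have h2 := hholes a₁
    have hsub : ((a +ᵥ subgroupFinset F) \ A) ∪ ((a₁ +ᵥ subgroupFinset F) \ A) ⊆
        (A + subgroupFinset F) \ A := by
      rw [← Finset.union_sdiff_distrib]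
      have := add_subgroupFinset_periodic A F
      refine Finset.sdiff_subset_sdiff (Finset.union_subset ?_ ?_) subset_rfl
      · exact coset_subset_of_periodic this (subset_add_subgroupFinset A F ha)
      · exact coset_subset_of_periodic this (subset_add_subgroupFinset A F ha₁)
    have hcard := Finset.card_le_card hsub
    rw [Finset.card_union_of_disjoint ((disjoint_cosets hG haF).mono Finset.sdiff_subset
      Finset.sdiff_subset), Finset.card_sdiff_of_subset (subset_add_subgroupFinset A F)] at hcard
    omega
  · push Not at hl
    obtain ⟨a₁, ha₁⟩ := hA
    exact ⟨a₁, ha₁, fun a ha _ => hl a ha⟩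

/-- If `F` is extremal then the union of the cosets of `F` that meet `C` is either a single coset,
or has at most three cosets, or `A + C` is large. -/
theorem three_mul_card_le_of_extremal (hG : ∀ g : G, g + g = 0) {A C : Finset G}
    (hA : A.Nonempty) {F : AddSubgroup G}
    (hFA : #(A + subgroupFinset F) < #A + #(subgroupFinset F))
    (hF : ∀ X, IsSeparating A F X → #X + #(A + subgroupFinset F) ≤ #(X + A))
    (hC : 4 * #(subgroupFinset F) ≤ #(C + subgroupFinset F))
    (hfill : #(C + subgroupFinset F + A) < #(C + subgroupFinset F) + #(A + subgroupFinset F))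
    (hbig : Fintype.card G < #(C + subgroupFinset F + A) + 2 * #(subgroupFinset F)) :
    3 * Fintype.card G ≤ 8 * #(A + C) := by
  obtain ⟨a₁, ha₁, hhalf⟩ := exists_forall_half_le hG hA hFA
  have hpos := card_subgroupFinset_pos F
  have hCF := add_subgroupFinset_periodic C F
  have hAF := add_subgroupFinset_periodic A F
  have hCFA := periodic_add_right (A := A) hCF
  have hdG : #(subgroupFinset F) ∣ Fintype.card G :=
    ⟨F.index, by rw [mul_comm, index_mul_card_subgroupFinset]⟩
  have hgap := add_le_of_dvd_of_lt (card_subgroupFinset_dvd hCFA)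
    (Nat.dvd_add (card_subgroupFinset_dvd hCF) (card_subgroupFinset_dvd hAF)) hfill
  -- Discard the one possibly sparse coset. Every coset of `F` in `A' + C` is then at least half
  -- filled by `A + C`.
  set A' := (A + subgroupFinset F) \ (a₁ +ᵥ subgroupFinset F) with hA'
  have hA'p : A' + subgroupFinset F = A' := by
    rw [hA', Finset.sdiff_eq_inter_compl]
    exact periodic_inter hAF (periodic_compl (coset_periodic a₁ F))
  set U := A' + C with hU
  have hUp : U + subgroupFinset F = U := periodic_add_right hA'p
  have hUhalf : #U ≤ 2 * #(A + C) := by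
    refine card_le_two_mul_card_of_half hG (F := F) fun y hy => ?_
    obtain ⟨a', ha', c, hc, rfl⟩ := Finset.mem_add.1 hy
    rw [hA', Finset.mem_sdiff, mem_vadd_subgroupFinset hG] at ha'
    obtain ⟨ha'1, ha'2⟩ := ha'
    obtain ⟨a, ha, g, hg, rfl⟩ := Finset.mem_add.1 ha'1
    rw [mem_subgroupFinset] at hg
    have haF : a + a₁ ∉ F := fun h => ha'2 (by
      rw [← add_assoc, add_comm a₁ a]; exact F.add_mem h hg)
    refine (hhalf a ha haF).trans ?_
    gcongr 2 * ?_
    rw [← Finset.card_vadd_finset c]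
    refine Finset.card_le_card fun z hz => ?_
    obtain ⟨x, hx, rfl⟩ := Finset.mem_vadd_finset.1 hz
    rw [Finset.mem_inter, mem_vadd_subgroupFinset hG] at hx
    rw [Finset.mem_inter, mem_vadd_subgroupFinset hG, vadd_eq_add]
    refine ⟨by rw [add_comm c]; exact Finset.add_mem_add hx.1 hc, ?_⟩
    have : a + g + c + (c + x) = (a + x) + g := by
      rw [add_assoc (a + g), self_add_add_self hG, add_right_comm]
    rw [this]
    exact F.add_mem hx.2 hg
  -- If `U` missed two cosets of `F`, their union `V` would be separating, and `V + A` too small for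
  -- `hF`.
  have hUc : #Uᶜ < 2 * #(subgroupFinset F) := by
    by_contra! hUc
    have hUcp := periodic_compl hUp
    have hpick : ∀ v ∈ Uᶜ, ∃ w ∈ Uᶜ, v + w ∉ F := by
      intro v _
      by_contra! hcon
      have := Finset.card_le_card (show Uᶜ ⊆ v +ᵥ subgroupFinset F from fun w hw =>
        (mem_vadd_subgroupFinset hG).2 (hcon w hw))
      rw [Finset.card_vadd_finset] at this
      omega
    have hcover : ∀ v ∈ Uᶜ, ∀ a ∈ A, a + v ∈ C + subgroupFinset F → a + a₁ ∈ F := by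
      intro v hv a ha hav
      by_contra haF
      rw [Finset.mem_compl] at hv
      apply hv
      obtain ⟨c, hc, g, hg, hcg⟩ := Finset.mem_add.1 hav
      have hv' : v = a + c + g := by
        rw [add_assoc, hcg, self_add_add_self hG]
      rw [hv']
      refine add_mem_of_periodic hUp (Finset.add_mem_add ?_ hc) (by simpa using hg)
      rw [hA', Finset.mem_sdiff, mem_vadd_subgroupFinset hG, add_comm a₁]
      exact ⟨subset_add_subgroupFinset A F ha, haF⟩
    have hcc := Finset.card_add_card_compl (C + subgroupFinset F)
    by_cases hW : ∃ v, v ∉ C + subgroupFinset F + A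
    · obtain ⟨v, hv⟩ := hW
      have hvU : v ∈ Uᶜ := by
        rw [Finset.mem_compl]
        intro h
        apply hv
        obtain ⟨a', ha', c, hc, rfl⟩ := Finset.mem_add.1 h
        rw [hA', Finset.mem_sdiff] at ha'
        have := Finset.add_mem_add ha'.1 hc
        rwa [add_comm, ← add_assoc, add_right_comm] at this
      obtain ⟨w, hwU, hvw⟩ := hpick v hvU
      set V := (v +ᵥ subgroupFinset F) ∪ (w +ᵥ subgroupFinset F) with hV
      have hVc : #V = 2 * #(subgroupFinset F) := by
        rw [hV, Finset.card_union_of_disjoint (disjoint_cosets hG hvw), Finset.card_vadd_finset,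
          Finset.card_vadd_finset, two_mul]
      -- As `v` is missed even by `C + F + A`, only the coset of `w` can reach `C + F`, and only
      -- through `a₁ + F`.
      have hVA : V + A ⊆ (C + subgroupFinset F)ᶜ ∪ ((a₁ + w) +ᵥ subgroupFinset F) := by
        intro z hz
        obtain ⟨x, hx, a, ha, rfl⟩ := Finset.mem_add.1 hz
        rw [Finset.mem_union, Finset.mem_compl, mem_vadd_subgroupFinset hG]
        by_contra! hcon
        obtain ⟨h1, h2⟩ := hcon
        rw [add_comm x a] at h1
        rcases Finset.mem_union.1 hx with hx | hx
        · apply hv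
          have hx' : x ∈ C + subgroupFinset F + A := by
            have := Finset.add_mem_add h1 ha
            rwa [add_comm (a + x), self_add_add_self hG] at this
          rw [mem_vadd_subgroupFinset hG] at hx
          have := add_mem_of_periodic hCFA hx' hx
          rwa [add_comm v x, self_add_add_self hG] at this
        · have hxU := coset_subset_of_periodic hUcp hwU hx
          have haF := hcover x hxU a ha h1
          apply h2
          rw [mem_vadd_subgroupFinset hG] at hx
          have := F.add_mem haF hx
          rwa [show a + a₁ + (w + x) = a₁ + w + (x + a) by abel] at this
      have hVA' := Finset.card_le_card hVA
      have hun := Finset.card_union_le (C + subgroupFinset F)ᶜ ((a₁ + w) +ᵥ subgroupFinset F)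
      rw [Finset.card_vadd_finset] at hun
      have hlt : #(C + subgroupFinset F + A) < Fintype.card G := by
        rw [← Finset.card_univ]
        exact Finset.card_lt_card (Finset.ssubset_univ_iff.2 fun h => hv (h ▸ Finset.mem_univ v))
      have hle := add_le_of_dvd_of_lt (card_subgroupFinset_dvd hCFA) hdG hlt
      have hge := add_le_of_dvd_of_lt hdG
        (Nat.dvd_add (card_subgroupFinset_dvd hCFA) (Nat.dvd_mul_left _ 2)) hbig
      have := hF V ⟨periodic_union (coset_periodic v F) (coset_periodic w F), hVc.ge, by omega⟩
      omega
    · push Not at hW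
      have hall : #(C + subgroupFinset F + A) = Fintype.card G := by
        rw [← Finset.card_univ, Finset.eq_univ_of_forall hW]
      obtain ⟨v, hvU⟩ : Uᶜ.Nonempty := Finset.card_pos.1 (by omega)
      obtain ⟨w, hwU, hvw⟩ := hpick v hvU
      set V := (v +ᵥ subgroupFinset F) ∪ (w +ᵥ subgroupFinset F) with hV
      have hVp : V + subgroupFinset F = V :=
        periodic_union (coset_periodic v F) (coset_periodic w F)
      have hVc : #V = 2 * #(subgroupFinset F) := by
        rw [hV, Finset.card_union_of_disjoint (disjoint_cosets hG hvw), Finset.card_vadd_finset,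
          Finset.card_vadd_finset, two_mul]
      -- Here both cosets may reach `C + F` through `a₁ + F`. The extra `|F|` lost is offset by `C +
      -- F + A` being everything, and `hC` still leaves two cosets outside.
      have hVA : V + A ⊆ (C + subgroupFinset F)ᶜ ∪ (a₁ +ᵥ V) := by
        intro z hz
        obtain ⟨x, hx, a, ha, rfl⟩ := Finset.mem_add.1 hz
        rw [Finset.mem_union, Finset.mem_compl]
        by_contra! hcon
        obtain ⟨h1, h2⟩ := hcon
        rw [add_comm x a] at h1
        have hxU : x ∈ Uᶜ := by
          rcases Finset.mem_union.1 hx with hx | hx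
          · exact coset_subset_of_periodic hUcp hvU hx
          · exact coset_subset_of_periodic hUcp hwU hx
        have haF := hcover x hxU a ha h1
        apply h2
        refine Finset.mem_vadd_finset.2 ⟨_, add_mem_of_periodic hVp hx haF, ?_⟩
        rw [vadd_eq_add, show a₁ + (x + (a + a₁)) = a₁ + (a₁ + (x + a)) by abel,
          self_add_add_self hG]
      have hVA' := Finset.card_le_card hVA
      have hun := Finset.card_union_le (C + subgroupFinset F)ᶜ (a₁ +ᵥ V)
      rw [Finset.card_vadd_finset] at hun
      have := hF V ⟨hVp, hVc.ge, by omega⟩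
      omega
  -- Now `|U| ≥ |G| - |F| ≥ 3/4 * |G|`, since `hC` gives `|G| ≥ 4 |F|`; half of `|U|` yields the
  -- `3/8`.
  have h1 := add_le_of_dvd_of_lt (card_subgroupFinset_dvd (periodic_compl hUp))
    (Nat.dvd_mul_left _ 2) hUc
  have h2 := Finset.card_add_card_compl U
  have h3 := Finset.card_le_univ (C + subgroupFinset F)
  omega

/-- Serves the case where `C` meets two or three cosets of `F`, with `A` meeting `n + 1` of the `2 ^
j`. -/
theorem two_pow_le_two_mul {j n : ℕ} (hj : j ≠ 0) (hjn : j ≤ n) (h : 2 ^ j ≤ n + 4) :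
    2 ^ j ≤ 2 * n := by
  rcases j with _ | _ | _ | j
  · omega
  · norm_num; omega
  · norm_num; omega
  · have : 2 ^ (j + 1 + 1 + 1) = 8 * 2 ^ j := by ring
    have := Nat.one_le_two_pow (n := j)
    omega

/-- In an elementary abelian `2`-group, if `A` spans and `|A + C| < |A| + |C|` is small, then `C`
is contained in a coset of a proper subgroup `F` such that fewer than `|F|` elements are missing
from the `F`-cosets that meet `A`. -/
theorem exists_subgroup_of_card_add_lt (hG : ∀ g : G, g + g = 0) {A C : Finset G}
    (hspan : ∀ a₀ ∈ A, ∀ K : AddSubgroup G, (∀ a ∈ A, a + a₀ ∈ K) → K = ⊤)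
    (hA : A.Nonempty) (hC : C.Nonempty) (hcrit : #(A + C) < #A + #C)
    (hsmall : 8 * #(A + C) < 3 * Fintype.card G) :
    ∃ F : AddSubgroup G, F ≠ ⊤ ∧ (∀ c ∈ C, ∀ c' ∈ C, c + c' ∈ F) ∧
      #(A + subgroupFinset F) < #A + #(subgroupFinset F) := by
  have hpos : 0 < #(A + C) := (hA.add hC).card_pos
  have hAle : #A ≤ #(A + C) := Finset.card_le_card_add_right hC
  have hCle : #C ≤ #(A + C) := Finset.card_le_card_add_left hA
  rcases Nat.eq_or_lt_of_le (Finset.card_pos.2 hC) with hC1 | hC2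
  · obtain ⟨c, rfl⟩ := Finset.card_eq_one.1 hC1.symm
    refine ⟨⊥, fun h => ?_, by simp [hG], by simp [subgroupFinset_bot]⟩
    have := index_mul_card_subgroupFinset (⊥ : AddSubgroup G)
    rw [card_subgroupFinset_bot, h, AddSubgroup.index_top] at this
    omega
  have hsepC : IsSeparating A ⊥ C := by
    refine ⟨by simp [subgroupFinset_bot], ?_, ?_⟩
    · rw [card_subgroupFinset_bot]; omega
    · rw [card_subgroupFinset_bot, add_comm C]; omega
  obtain ⟨K₀, -, hK₀⟩ := exists_separating_subgroup hG ⟨C, hsepC⟩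
  obtain ⟨F, ⟨hFsep, hFmin⟩, hFmax⟩ := (Set.toFinite {F : AddSubgroup G |
    IsSeparating A ⊥ (subgroupFinset F) ∧ ∀ X, IsSeparating A ⊥ X →
      boundarySize A (subgroupFinset F) ≤ boundarySize A X}).exists_maximal ⟨K₀, hK₀⟩
  have hfpos := card_subgroupFinset_pos F
  have hFC := hFmin C hsepC
  have hbC : boundarySize A C ≤ #A - 1 := by
    unfold boundarySize
    rw [add_comm C]
    omega
  have hFA : #(A + subgroupFinset F) < #A + #(subgroupFinset F) := by
    unfold boundarySize at hFC hbC
    rw [add_comm (subgroupFinset F)] at hFC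
    omega
  have hFtop : F ≠ ⊤ := by
    rintro rfl
    have h1 := hFsep.card_add_le
    have h2 := index_mul_card_subgroupFinset (⊤ : AddSubgroup G)
    have h3 : #(subgroupFinset (⊤ : AddSubgroup G)) ≤ #(subgroupFinset ⊤ + A) :=
      Finset.card_le_card_add_right hA
    rw [card_subgroupFinset_bot] at h1
    rw [AddSubgroup.index_top] at h2
    omega
  have hCF := add_subgroupFinset_periodic C F
  have hAF := add_subgroupFinset_periodic A F
  refine ⟨F, hFtop, ?_, hFA⟩
  by_contra hcon
  push Not at hcon
  obtain ⟨c, hc, c', hc', hcc⟩ := hcon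
  have hC2F := two_mul_card_le_of_periodic hG hCF (subset_add_subgroupFinset C F hc)
    (subset_add_subgroupFinset C F hc') hcc
  -- A violation would, after rounding to multiples of `|F|`, produce a strictly larger subgroup
  -- with boundary no greater than that of `F`.
  have hstar : ∀ X, IsSeparating A F X → #X + #(A + subgroupFinset F) ≤ #(X + A) := by
    intro X hX
    by_contra! hlt
    have hgap := add_le_of_dvd_of_lt
      (card_subgroupFinset_dvd (periodic_add_right (A := A) hX.periodic))
      (Nat.dvd_add (card_subgroupFinset_dvd hX.periodic) (card_subgroupFinset_dvd hAF)) hlt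
    obtain ⟨K, hFK, hKsep, hKmin⟩ := exists_separating_subgroup hG ⟨X, hX⟩
    have hKX := hKmin X hX
    have hXF : boundarySize A X ≤ boundarySize A (subgroupFinset F) := by
      unfold boundarySize
      rw [add_comm (subgroupFinset F)]
      omega
    have h1 := hKsep.two_mul_le
    have h2 := hKsep.card_add_le
    have hKbot : IsSeparating A ⊥ (subgroupFinset K) := by
      refine ⟨by simp [subgroupFinset_bot], ?_, ?_⟩ <;> rw [card_subgroupFinset_bot] <;> omega
    have hKF : K ≤ F := hFmax ⟨hKbot, fun Y hY => (hKX.trans hXF).trans (hFmin Y hY)⟩ hFK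
    rw [le_antisymm hKF hFK] at h1
    omega
  have hfill := boundarySize_add_subgroup_le hFsep hFmin (hFC.trans hbC) C
  have hAAF := Finset.card_le_card (subset_add_subgroupFinset A F)
  have hfill' : #(C + subgroupFinset F + A) <
      #(C + subgroupFinset F) + #(A + subgroupFinset F) := by
    unfold boundarySize at hfill hbC
    omega
  have hbig : Fintype.card G < #(C + subgroupFinset F + A) + 2 * #(subgroupFinset F) := by
    by_contra! hle
    have := hstar _ ⟨hCF, hC2F, hle⟩
    omega
  rcases le_or_gt (4 * #(subgroupFinset F)) #(C + subgroupFinset F) with h4 | h4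
  · have := three_mul_card_le_of_extremal hG hA hFA hstar h4 hfill' hbig
    omega
  -- With at most three cosets in `C + F`, the sum `C + F + A` has at most `n + 3`, so `2 ^ j ≤ n +
  -- 4`. Then `|A| > n * |F| ≥ |G| / 2`, too large.
  · obtain ⟨a₀, ha₀⟩ := hA
    obtain ⟨n, hn, hindex⟩ := exists_card_add_eq_of_span hG (F := F) ha₀
      fun K _ hK => hspan a₀ ha₀ K hK
    obtain ⟨j, hj⟩ := exists_index_eq_two_pow hG F
    have hG' := index_mul_card_subgroupFinset F
    have h3 := add_le_of_dvd_of_lt (card_subgroupFinset_dvd hCF) (Nat.dvd_mul_left _ 4) h4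
    have hgap := add_le_of_dvd_of_lt
      (card_subgroupFinset_dvd (periodic_add_right (A := A) hCF))
      (Nat.dvd_add (card_subgroupFinset_dvd hCF) (card_subgroupFinset_dvd hAF)) hfill'
    rw [hj] at hindex hG'
    have hj0 : j ≠ 0 := by
      rintro rfl
      exact hFtop (AddSubgroup.index_eq_one.1 (by simpa using hj))
    have hjn := (Nat.pow_le_pow_iff_right (by norm_num)).1 hindex
    have h5 : 2 ^ j * #(subgroupFinset F) < (n + 5) * #(subgroupFinset F) := by
      have : (n + 5) * #(subgroupFinset F) =
        (n + 1) * #(subgroupFinset F) + 4 * #(subgroupFinset F) := by ring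
      omega
    have h6 := Nat.lt_of_mul_lt_mul_right h5
    have h7 := Nat.mul_le_mul_right #(subgroupFinset F)
      (two_pow_le_two_mul hj0 hjn (by omega))
    have : (n + 1) * #(subgroupFinset F) = n * #(subgroupFinset F) + #(subgroupFinset F) := by
      ring
    rw [mul_assoc] at h7
    omega
end

/-- Puts `(k + 1) / 2 ^ k` below the threshold `3/8`; it fails at `k = 3`. -/
theorem eight_mul_succ_lt (k : ℕ) (hk : 4 ≤ k) : 8 * (k + 1) < 3 * 2 ^ k := by
  induction k, hk using Nat.le_induction with
  | base => norm_num
  | succ k hk ih => rw [pow_succ]; omega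

/-- Rules out `j < k`: there `j / 2 ^ j` is at least `(k + 1) / 2 ^ k`. -/
theorem succ_mul_two_pow_le {j k : ℕ} (hj : j ≠ 0) (hjk : j < k) (hk : 4 ≤ k) :
    (k + 1) * 2 ^ j ≤ j * 2 ^ k := by
  obtain ⟨i, rfl⟩ := Nat.exists_eq_add_of_lt hjk
  have key : j + i + 2 ≤ j * 2 ^ (i + 1) := by
    rcases i with _ | i
    · omega
    · induction i with
      | zero => omega
      | succ i ih =>
        rcases Nat.lt_or_ge (j + (i + 1)) 3 with h | h
        · have hj1 : j = 1 := by omega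
          have hi : i = 0 := by omega
          subst hj1 hi
          norm_num
        · have := ih (by omega) (by omega)
          have e : 2 ^ (i + 1 + 1 + 1) = 2 * 2 ^ (i + 1 + 1) := by ring
          rw [e, Nat.mul_left_comm]
          omega
  have : 2 ^ (j + i + 1) = 2 ^ (i + 1) * 2 ^ j := by rw [← pow_add]; congr 1; omega
  rw [this, ← mul_assoc]
  exact Nat.mul_le_mul_right _ key

/-! ### The structure theorem, strict containment and sharpness. -/

section
variable {G : Type*} [AddCommGroup G]

theorem eq_top_of_cosetSpan_eq_univ (hG : ∀ g : G, g + g = 0) {A : Finset G}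
    (hA : cosetSpan (A : Set G) = Set.univ) {a₀ : G} (ha₀ : a₀ ∈ A) (K : AddSubgroup G)
    (hK : ∀ a ∈ A, a + a₀ ∈ K) : K = ⊤ := by
  have hne : (A : Set G).Nonempty := ⟨a₀, ha₀⟩
  have hle := (isLeast_cosetSpan hne).2 (show a₀ +ᵥ (K : Set G) ∈ _ from ⟨⟨K, a₀, rfl⟩, by
    intro a ha
    rw [Set.mem_vadd_set_iff_neg_vadd_mem, neg_eq_self_of_add_self hG, vadd_eq_add, add_comm]
    exact hK a ha⟩)
  rw [hA] at hle
  ext x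
  have := hle (Set.mem_univ (a₀ + x))
  rw [Set.mem_vadd_set_iff_neg_vadd_mem, vadd_eq_add, neg_add_cancel_left] at this
  simpa using this

theorem cosetSpan_eq_univ (hG : ∀ g : G, g + g = 0) {A : Finset G} {a₀ : G} (ha₀ : a₀ ∈ A)
    (h : ∀ K : AddSubgroup G, (∀ a ∈ A, a + a₀ ∈ K) → K = ⊤) :
    cosetSpan (A : Set G) = Set.univ := by
  have hne : (A : Set G).Nonempty := ⟨a₀, ha₀⟩
  obtain ⟨⟨K, g, hKg⟩, hAK⟩ := (isLeast_cosetSpan hne).1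
  rw [hKg] at hAK ⊢
  have hmem : ∀ a ∈ A, g + a ∈ K := fun a ha => by
    have := hAK ha
    rwa [Set.mem_vadd_set_iff_neg_vadd_mem, neg_eq_self_of_add_self hG] at this
  have hK := h K fun a ha => by
    have := K.add_mem (hmem a ha) (hmem a₀ ha₀)
    rwa [add_add_add_comm, hG, zero_add] at this
  ext x
  simp [hK]

theorem nonempty_of_cosetSpan_eq_univ {A : Finset G} (hA : cosetSpan (A : Set G) = Set.univ) :
    A.Nonempty := by
  rw [Finset.nonempty_iff_ne_empty]
  rintro rfl
  rw [Finset.coe_empty, cosetSpan_empty] at hA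
  exact Set.empty_ne_univ hA

variable [DecidableEq G]

theorem exists_unique_rep_of_minRepCount_eq_one {A B : Finset G} (h : minRepCount A B = 1) :
    ∃ a ∈ A, ∃ b ∈ B, ∀ a' ∈ A, ∀ b' ∈ B, a' + b' = a + b → a' = a := by
  -- The infimum over the empty set is `0`, so the value `1` is really attained.
  have hne : ((fun g : G => A.addConvolution B g) '' ((A + B : Finset G) : Set G)).Nonempty := by
    rw [Set.nonempty_iff_ne_empty]
    intro h0
    rw [minRepCount, h0] at h
    simp at h
  have hmem := Nat.sInf_mem hne
  rw [← minRepCount, h] at hmem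
  obtain ⟨g, hg, hg1⟩ := hmem
  obtain ⟨a, ha, b, hb, rfl⟩ := Finset.mem_add.1 hg
  refine ⟨a, ha, b, hb, fun a' ha' b' hb' heq => ?_⟩
  have h1 : #{x ∈ A ×ˢ B | x.1 + x.2 = a + b} = 1 := hg1
  have := Finset.card_le_one.1 h1.le (a', b') (by simp [ha', hb', heq]) (a, b) (by simp [ha, hb])
  exact congrArg Prod.fst this

variable [Fintype G]

/-- A set with more than half of the elements spans. -/
theorem cosetSpan_eq_univ_of_card (hG : ∀ g : G, g + g = 0) {B : Finset G}
    (hB : Fintype.card G < 2 * #B) : cosetSpan (B : Set G) = Set.univ := by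
  obtain ⟨b, hb⟩ : B.Nonempty := Finset.card_pos.1 (by omega)
  refine cosetSpan_eq_univ hG hb fun K hK => ?_
  have hsub : B ⊆ b +ᵥ subgroupFinset K := fun x hx =>
    (mem_vadd_subgroupFinset hG).2 (by rw [add_comm]; exact hK x hx)
  have hle := Finset.card_le_card hsub
  rw [Finset.card_vadd_finset] at hle
  have hidx := index_mul_card_subgroupFinset K
  have h0 : K.index ≠ 0 := AddSubgroup.index_ne_zero_of_finite
  rw [← AddSubgroup.index_eq_one]
  by_contra h1
  have := Nat.mul_le_mul_right #(subgroupFinset K) (show 2 ≤ K.index by omega)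
  omega

/-- If `a + c = b` then `c = a + b` in characteristic 2. This duality trades the large set `B` for
the small complement of `A + B`. -/
theorem add_compl_subset_compl (hG : ∀ g : G, g + g = 0) (A B : Finset G) :
    A + (A + B)ᶜ ⊆ Bᶜ := by
  intro z hz
  obtain ⟨a, ha, c, hc, rfl⟩ := Finset.mem_add.1 hz
  rw [Finset.mem_compl] at hc ⊢
  intro h
  apply hc
  have := Finset.add_mem_add ha h
  rwa [self_add_add_self hG] at this

theorem card_bound_iff {k b m : ℕ} :
    (b : ℝ) ≥ (1 - ((k : ℝ) + 1) / 2 ^ k) * (m : ℝ) ↔ 2 ^ k * m ≤ 2 ^ k * b + (k + 1) * m := by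
  have h2 : (0 : ℝ) < 2 ^ k := by positivity
  have h : (1 - ((k : ℝ) + 1) / 2 ^ k) * (m : ℝ) = (2 ^ k * m - (k + 1) * m) / 2 ^ k := by
    field_simp
  rw [ge_iff_le, h, div_le_iff₀ h2, sub_le_iff_le_add, mul_comm (b : ℝ)]
  exact_mod_cast Iff.rfl

/-- The complement of `A + B` lies in a coset of a subgroup of index `2 ^ k`. -/
theorem exists_coset_of_index_two_pow (hG : ∀ g : G, g + g = 0) {k : ℕ} (hk : 4 ≤ k)
    {A B : Finset G} (hA : cosetSpan (A : Set G) = Set.univ)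
    (hsum : #(A + B) < #A + #B) (huniv : #(A + B) < Fintype.card G)
    (hB : 2 ^ k * Fintype.card G ≤ 2 ^ k * #B + (k + 1) * Fintype.card G) :
    ∃ (H : AddSubgroup G) (g : G), H.index = 2 ^ k ∧
      (((A + B)ᶜ : Finset G) : Set G) ⊆ g +ᵥ (H : Set G) := by
  have hAne := nonempty_of_cosetSpan_eq_univ hA
  have hc1 := Finset.card_add_card_compl (A + B)
  have hc2 := Finset.card_add_card_compl B
  obtain ⟨c, hc⟩ : ((A + B)ᶜ).Nonempty := Finset.card_pos.1 (by omega)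
  have hsub := Finset.card_le_card (add_compl_subset_compl hG A B)
  have hAC : 2 ^ k * #(A + (A + B)ᶜ) ≤ (k + 1) * Fintype.card G := by
    have := Nat.mul_le_mul_left (2 ^ k) hsub
    have h' : 2 ^ k * #B + 2 ^ k * #Bᶜ = 2 ^ k * Fintype.card G := by rw [← mul_add, hc2]
    omega
  have hGpos : 0 < Fintype.card G := by omega
  have hkpos := Nat.pow_pos (n := k) (show 0 < 2 by norm_num)
  obtain ⟨F, hFtop, hCF, hFA⟩ := exists_subgroup_of_card_add_lt hG
    (fun a₀ ha₀ K hK => eq_top_of_cosetSpan_eq_univ hG hA ha₀ K hK) hAne ⟨c, hc⟩ (by omega) (by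
      have h1 := Nat.mul_lt_mul_of_pos_right (eight_mul_succ_lt k hk) hGpos
      nlinarith)
  obtain ⟨j, hj⟩ := exists_index_eq_two_pow hG F
  have hj0 : j ≠ 0 := by
    rintro rfl
    exact hFtop (AddSubgroup.index_eq_one.1 (by simpa using hj))
  obtain ⟨a₀, ha₀⟩ := hAne
  obtain ⟨n, hn, hindex⟩ := exists_card_add_eq_of_span hG (F := F) ha₀
    fun K _ hK => eq_top_of_cosetSpan_eq_univ hG hA ha₀ K hK
  rw [hj] at hindex
  have hjn := (Nat.pow_le_pow_iff_right (by norm_num)).1 hindex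
  -- `A` misses fewer than `|F|` elements of its `n + 1 ≥ j + 1` cosets.
  have hjA : j * #(subgroupFinset F) < #(A + (A + B)ᶜ) := by
    have h1 : #A ≤ #(A + (A + B)ᶜ) := Finset.card_le_card_add_right ⟨c, hc⟩
    have h2 := Nat.mul_le_mul_right #(subgroupFinset F) hjn
    rw [add_mul, one_mul] at hn
    omega
  have hkj : k ≤ j := by
    by_contra! hjk
    have h1 := Nat.mul_le_mul_right #(subgroupFinset F) (succ_mul_two_pow_le hj0 hjk hk)
    have hidx := index_mul_card_subgroupFinset F
    rw [hj] at hidx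
    rw [← hidx] at hAC
    nlinarith
  obtain ⟨i, rfl⟩ := Nat.exists_eq_add_of_le hkj
  obtain ⟨H, hFH, hH⟩ := exists_le_index_eq_two_pow hG i k F hj
  refine ⟨H, c, hH, fun x hx => ?_⟩
  rw [Set.mem_vadd_set_iff_neg_vadd_mem, neg_eq_self_of_add_self hG]
  exact hFH (hCF c hc x hx)

/-- If the complement of `A + B` is a coset of a subgroup of index `2 ^ k`, then no element of
`A + B` has a unique representation. -/
theorem minRepCount_ne_one_of_compl_eq_coset (hG : ∀ g : G, g + g = 0) {k : ℕ} (hk : 4 ≤ k)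
    {A B : Finset G} (hA : cosetSpan (A : Set G) = Set.univ)
    (hB : 2 ^ k * Fintype.card G ≤ 2 ^ k * #B + (k + 1) * Fintype.card G)
    {H : AddSubgroup G} {g : G} (hH : H.index = 2 ^ k)
    (hcoset : (A + B)ᶜ = g +ᵥ subgroupFinset H) : minRepCount A B ≠ 1 := by
  intro hmin
  obtain ⟨a, ha, b, hb, huniq⟩ := exists_unique_rep_of_minRepCount_eq_one hmin
  have hpos := card_subgroupFinset_pos H
  have hidx := index_mul_card_subgroupFinset H
  rw [hH] at hidx
  have hcB := Finset.card_add_card_compl B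
  have hkpos := Nat.pow_pos (n := k) (show 0 < 2 by norm_num)
  have hBc : #Bᶜ ≤ (k + 1) * #(subgroupFinset H) := by
    refine Nat.le_of_mul_le_mul_left ?_ hkpos
    have h' : 2 ^ k * #B + 2 ^ k * #Bᶜ = 2 ^ k * Fintype.card G := by rw [← mul_add, hcB]
    calc 2 ^ k * #Bᶜ ≤ (k + 1) * Fintype.card G := by omega
      _ = 2 ^ k * ((k + 1) * #(subgroupFinset H)) := by rw [← hidx]; ring
  obtain ⟨n, hn, hindex⟩ := exists_card_add_eq_of_span hG (F := H) ha
    fun K _ hK => eq_top_of_cosetSpan_eq_univ hG hA ha K hK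
  rw [hH] at hindex
  have hkn := (Nat.pow_le_pow_iff_right (by norm_num)).1 hindex
  have hge : (k + 1) * #(subgroupFinset H) ≤ #(A + subgroupFinset H) := by
    rw [hn]
    exact Nat.mul_le_mul_right _ (by omega)
  -- `B` is the complement of the translate of `A + H` by `g`
  have hsub : g +ᵥ (A + subgroupFinset H) ⊆ Bᶜ := by
    have := add_compl_subset_compl hG A B
    rwa [hcoset, add_comm A, vadd_add_assoc, add_comm (subgroupFinset H)] at this
  have hBeq : g +ᵥ (A + subgroupFinset H) = Bᶜ :=
    Finset.eq_of_subset_of_card_le hsub (by rw [Finset.card_vadd_finset]; exact hBc.trans hge)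
  have hAH : #(A + subgroupFinset H) = (k + 1) * #(subgroupFinset H) := by
    refine le_antisymm ?_ hge
    rw [← Finset.card_vadd_finset g, hBeq]
    exact hBc
  have hmemB : ∀ x, x ∉ B ↔ g + x ∈ A + subgroupFinset H := by
    intro x
    rw [← Finset.mem_compl, ← hBeq, ← Finset.neg_vadd_mem_iff, neg_eq_self_of_add_self hG,
      vadd_eq_add]
  have hAHp := add_subgroupFinset_periodic A H
  set d := g + (a + b) with hd
  have hdH : d ∉ H := by
    intro h
    have : a + b ∈ (A + B)ᶜ := by
      rw [hcoset, mem_vadd_subgroupFinset hG]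
      exact h
    exact (Finset.mem_compl.1 this) (Finset.add_mem_add ha hb)
  -- translation by `d` preserves the union of the cosets of `H` that meet `A` but not `a + H`
  have htrans : ∀ x ∈ A, x + a ∉ H → d + x ∈ A + subgroupFinset H := by
    intro x hx hxa
    by_contra hcon
    -- Such an element would give the second representation `x + (a + b + x)` of `a + b`.
    have hxB : a + b + x ∈ B := by
      by_contra h
      rw [hmemB, ← add_assoc] at h
      exact hcon h
    have := huniq x hx _ hxB (by rw [add_comm (a + b), self_add_add_self hG])
    apply hxa
    rw [this, hG]
    exact H.zero_mem
  -- `A` meets `k + 1 > 3` cosets of `H`, so three can always be avoided.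
  have hpick : ∀ T : Finset G, #T ≤ 3 → ∃ x ∈ A, ∀ t ∈ T, x + t ∉ H := by
    intro T hT
    by_contra! hcon
    have hsubT : A + subgroupFinset H ⊆ T + subgroupFinset H := by
      intro z hz
      obtain ⟨x, hx, h, hh, rfl⟩ := Finset.mem_add.1 hz
      obtain ⟨t, ht, hxt⟩ := hcon x hx
      refine Finset.mem_add.2 ⟨t, ht, t + (x + h), ?_, self_add_add_self hG _ _⟩
      rw [mem_subgroupFinset, ← add_assoc, add_comm t]
      exact H.add_mem hxt (by simpa using hh)
    have h1 := (Finset.card_le_card hsubT).trans Finset.card_add_le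
    rw [hAH] at h1
    have := Nat.le_of_mul_le_mul_right h1 hpos
    omega
  obtain ⟨x₁, hx₁, hx₁T⟩ := hpick {a} (by simp)
  obtain ⟨x₃, hx₃, hx₃T⟩ := hpick {a, x₁, d + x₁} Finset.card_le_three
  simp only [Finset.mem_insert, Finset.mem_singleton, forall_eq_or_imp, forall_eq] at hx₁T hx₃T
  obtain ⟨h3a, h31, h3d⟩ := hx₃T
  -- Modulo `H`, `x₂ = d + x₁` and `x₄ = d + x₃`, so `x₁ + x₂ + x₃ + x₄ ∈ H`: an affine dependence
  -- making `x₄ + H` redundant.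
  obtain ⟨x₂, hx₂, h₂, hh₂, e₂⟩ := Finset.mem_add.1 (htrans x₁ hx₁ hx₁T)
  obtain ⟨x₄, hx₄, h₄, hh₄, e₄⟩ := Finset.mem_add.1 (htrans x₃ hx₃ h3a)
  rw [mem_subgroupFinset] at hh₂ hh₄
  have e₂' : x₂ = d + x₁ + h₂ := by rw [← e₂, add_assoc, hG, add_zero]
  have e₄' : x₄ = d + x₃ + h₄ := by rw [← e₄, add_assoc, hG, add_zero]
  have h14 : x₁ + x₄ ∉ H := fun h => h3d (by
    rw [e₄', show x₁ + (d + x₃ + h₄) = x₃ + (d + x₁) + h₄ by abel] at h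
    exact (H.add_mem_cancel_right hh₄).1 h)
  have h34 : x₃ + x₄ ∉ H := fun h => hdH (by
    rw [e₄', show x₃ + (d + x₃ + h₄) = x₃ + (x₃ + d) + h₄ by abel, self_add_add_self hG] at h
    exact (H.add_mem_cancel_right hh₄).1 h)
  have h24 : x₂ + x₄ ∉ H := fun h => h31 (by
    rw [e₂', e₄', show d + x₁ + h₂ + (d + x₃ + h₄) = d + (d + (x₃ + x₁)) + (h₂ + h₄) by abel,
      self_add_add_self hG] at h
    exact (H.add_mem_cancel_right (H.add_mem hh₂ hh₄)).1 h)
  -- hence deleting the coset `x₄ + H` leaves a spanning set with only `k` cosets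
  set A' := A \ (x₄ +ᵥ subgroupFinset H) with hA'
  have hmemA' : ∀ x, x ∈ A' ↔ x ∈ A ∧ x + x₄ ∉ H := fun x => by
    rw [hA', Finset.mem_sdiff, mem_vadd_subgroupFinset hG, add_comm]
  have hx₁A' := (hmemA' x₁).2 ⟨hx₁, h14⟩
  obtain ⟨m, hm, hmindex⟩ := exists_card_add_eq_of_span hG (F := H) hx₁A' fun K hHK hK => by
    refine eq_top_of_cosetSpan_eq_univ hG hA hx₁ K fun x hx => ?_
    by_cases hx4 : x + x₄ ∈ H
    · have h2 := hK x₂ ((hmemA' x₂).2 ⟨hx₂, h24⟩)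
      have h3 := hK x₃ ((hmemA' x₃).2 ⟨hx₃, h34⟩)
      have h5 := K.add_mem (K.add_mem h2 h3) (hHK (H.add_mem (H.add_mem hx4 hh₂) hh₄))
      rw [e₂', e₄', show d + x₁ + h₂ + x₁ + (x₃ + x₁) + (x + (d + x₃ + h₄) + h₂ + h₄) =
        d + (d + (x₁ + (x₁ + (x₃ + (x₃ + (h₂ + (h₂ + (h₄ + (h₄ + (x + x₁)))))))))) by abel] at h5
      simpa only [self_add_add_self hG] using h5
    · exact hK x ((hmemA' x).2 ⟨hx, hx4⟩)
  rw [hH] at hmindex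
  have hkm := (Nat.pow_le_pow_iff_right (by norm_num)).1 hmindex
  have hsubA' : A' + subgroupFinset H ⊆ (A + subgroupFinset H) \ (x₄ +ᵥ subgroupFinset H) := by
    intro z hz
    obtain ⟨x, hx, h, hh, rfl⟩ := Finset.mem_add.1 hz
    rw [hmemA'] at hx
    rw [Finset.mem_sdiff, mem_vadd_subgroupFinset hG, ← add_assoc, add_comm x₄]
    rw [mem_subgroupFinset] at hh
    exact ⟨Finset.add_mem_add hx.1 (by simpa using hh),
      fun h' => hx.2 ((H.add_mem_cancel_right hh).1 h')⟩
  have hcard := Finset.card_le_card hsubA'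
  rw [Finset.card_sdiff_of_subset (coset_subset_of_periodic hAHp
    (subset_add_subgroupFinset A H hx₄)), Finset.card_vadd_finset, hm, hAH] at hcard
  have := Nat.mul_le_mul_right #(subgroupFinset H) (show k + 1 ≤ m + 1 by omega)
  have : 0 < (k + 1) * #(subgroupFinset H) := by positivity
  omega

/-- The index `2 ^ k` is attained. -/
theorem exists_sharp_pair (hG : ∀ g : G, g + g = 0) {k : ℕ} (hk : 4 ≤ k)
    (hcard : 2 ^ k ≤ Fintype.card G) :
    ∃ A B : Finset G, cosetSpan (A : Set G) = Set.univ ∧ cosetSpan (B : Set G) = Set.univ ∧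
      #(A + B) < #A + #B ∧ #(A + B) < Fintype.card G ∧
      2 ^ k * Fintype.card G ≤ 2 ^ k * #B + (k + 1) * Fintype.card G ∧
      ∀ (H : AddSubgroup G) (g : G), 2 ^ k < H.index →
        ¬ (((A + B)ᶜ : Finset G) : Set G) ⊆ g +ᵥ (H : Set G) := by
  obtain ⟨j, hj⟩ := exists_index_eq_two_pow hG (⊥ : AddSubgroup G)
  have hbot := index_mul_card_subgroupFinset (⊥ : AddSubgroup G)
  rw [hj, card_subgroupFinset_bot, mul_one] at hbot
  rw [← hbot] at hcard
  obtain ⟨i, rfl⟩ := Nat.exists_eq_add_of_le ((Nat.pow_le_pow_iff_right (by norm_num)).1 hcard)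
  obtain ⟨F, -, hF⟩ := exists_le_index_eq_two_pow hG i k ⊥ hj
  obtain ⟨T, hT, hTgen⟩ := exists_finset_generating hG k F hF
  have hidx := index_mul_card_subgroupFinset F
  have hpos := card_subgroupFinset_pos F
  rw [hF] at hidx
  -- At most `k + 1` cosets of `F` that affinely span. With `B = Aᶜ`, the sum `A + B` misses all of
  -- `F`, which is too big for a coset of a subgroup of larger index.
  set A := insert 0 T + subgroupFinset F with hA
  have hAp : A + subgroupFinset F = A := add_subgroupFinset_periodic _ F
  have hAc : #A ≤ (k + 1) * #(subgroupFinset F) := by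
    refine Finset.card_add_le.trans (Nat.mul_le_mul_right _ ?_)
    exact (Finset.card_insert_le _ _).trans (by omega)
  have hsub : subgroupFinset F ⊆ (A + Aᶜ)ᶜ := by
    intro x hx
    rw [Finset.mem_compl]
    intro h
    obtain ⟨a, ha, b, hb, rfl⟩ := Finset.mem_add.1 h
    rw [Finset.mem_compl] at hb
    apply hb
    have := add_mem_of_periodic hAp ha (mem_subgroupFinset.1 hx)
    rwa [self_add_add_self hG] at this
  have hle := Finset.card_le_card hsub
  have hcA := Finset.card_add_card_compl A
  have hcS := Finset.card_add_card_compl (A + Aᶜ)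
  have hTA : ∀ t ∈ insert 0 T, ∀ g ∈ F, t + g ∈ A := fun t ht g hg =>
    Finset.add_mem_add ht (by simpa using hg)
  have h0A : (0 : G) ∈ A := by
    simpa using hTA 0 (Finset.mem_insert_self _ _) 0 F.zero_mem
  refine ⟨A, Aᶜ, ?_, ?_, by omega, by omega, ?_, ?_⟩
  · refine cosetSpan_eq_univ hG h0A fun K hK => hTgen K ?_ ?_
    · intro g hg
      simpa using hK _ (hTA 0 (Finset.mem_insert_self _ _) g hg)
    · intro t ht
      simpa using hK _ (hTA t (Finset.mem_insert_of_mem ht) 0 F.zero_mem)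
  · apply cosetSpan_eq_univ_of_card hG
    have := Nat.mul_lt_mul_of_pos_right (eight_mul_succ_lt k hk) hpos
    nlinarith
  · have := Nat.mul_le_mul_left (2 ^ k) hAc
    have h' : 2 ^ k * #A + 2 ^ k * #Aᶜ = 2 ^ k * Fintype.card G := by rw [← mul_add, hcA]
    have : 2 ^ k * ((k + 1) * #(subgroupFinset F)) = (k + 1) * Fintype.card G := by
      rw [← hidx]; ring
    omega
  · intro H g hH hcon
    have hFH : subgroupFinset F ⊆ g +ᵥ subgroupFinset H := by
      intro x hx
      have := hcon (Finset.mem_coe.2 (hsub hx))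
      rwa [Set.mem_vadd_set_iff_neg_vadd_mem, neg_eq_self_of_add_self hG, vadd_eq_add,
        SetLike.mem_coe, ← mem_vadd_subgroupFinset hG] at this
    have hle' := Finset.card_le_card hFH
    rw [Finset.card_vadd_finset] at hle'
    have hidxH := index_mul_card_subgroupFinset H
    have := Nat.mul_lt_mul_of_lt_of_le hH hle' (card_subgroupFinset_pos H)
    omega
end

theorem mainTheorem2 {G : Type*} [AddCommGroup G] [Fintype G] [DecidableEq G]
    (hG : ∀ g : G, g + g = 0) (k : ℕ) (hk : 4 ≤ k) :
    -- the structure theorem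
    (∀ A B : Finset G,
      cosetSpan (A : Set G) = Set.univ → cosetSpan (B : Set G) = Set.univ →
      #(A + B) < min (#A + #B) (Fintype.card G) →
      (#B : ℝ) ≥ (1 - ((k : ℝ) + 1) / 2 ^ k) * (Fintype.card G : ℝ) →
      (∃ (H : AddSubgroup G) (g : G), H.index = 2 ^ k ∧
        (((A + B)ᶜ : Finset G) : Set G) ⊆ g +ᵥ (H : Set G)) ∧
      (minRepCount A B = 1 →
        ∀ (H : AddSubgroup G) (g : G), H.index = 2 ^ k →
          (((A + B)ᶜ : Finset G) : Set G) ⊆ g +ᵥ (H : Set G) →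
          (((A + B)ᶜ : Finset G) : Set G) ⊂ g +ᵥ (H : Set G))) ∧
    -- the bound `2 ^ k` on the index is best possible
    (2 ^ k ≤ Fintype.card G →
      ∃ A B : Finset G,
        cosetSpan (A : Set G) = Set.univ ∧ cosetSpan (B : Set G) = Set.univ ∧
        #(A + B) < min (#A + #B) (Fintype.card G) ∧
        (#B : ℝ) ≥ (1 - ((k : ℝ) + 1) / 2 ^ k) * (Fintype.card G : ℝ) ∧
        ∀ (H : AddSubgroup G) (g : G), 2 ^ k < H.index →
          ¬ (((A + B)ᶜ : Finset G) : Set G) ⊆ g +ᵥ (H : Set G)) := by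
  refine ⟨fun A B hA _ hsum hB => ?_, fun hcard => ?_⟩
  · rw [lt_min_iff] at hsum
    rw [card_bound_iff] at hB
    refine ⟨exists_coset_of_index_two_pow hG hk hA hsum.1 hsum.2 hB, ?_⟩
    intro hmin H g hH hsub
    refine hsub.ssubset_of_ne fun heq => ?_
    refine minRepCount_ne_one_of_compl_eq_coset hG hk hA hB (g := g) hH ?_ hmin
    rw [← Finset.coe_inj, heq]
    ext x
    simp [Set.mem_vadd_set_iff_neg_vadd_mem]
  · obtain ⟨A, B, hA, hB, h1, h2, h3, h4⟩ := exists_sharp_pair hG hk hcard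
    exact ⟨A, B, hA, hB, lt_min h1 h2, card_bound_iff.2 h3, h4⟩
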